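/- Let $k$ be a field of characteristic zero. For subspaces $A,B$ of a $k$-vector space $V$ write $A<B$ if $(A+B)/B$ is finite dimensional, and $A\sim B$ if $(A+B)/(A\cap B)$ is finite dimensional. Put $E_A=\{\varphi\in\operatorname{End}_k(V):\varphi A<A\}$, $E_{1,A}=\{\varphi:\varphi V<A\}$ and $E_{2,A}=\{\varphi:\varphi A<\{0\}\}$. If an endomorphism $\varphi$ is finite potent (that is, $\varphi^nV$ is finite dimensional for some $n$), let $\operatorname{tr}_V(\varphi)$ be the trace of $\varphi$ on such a $\varphi^nV$. Let $K$ be a commutative $k$-algebra and let $V$ be a $K$-module (with the induced $k$-vector space structure). For a $k$-subspace $A\subseteq V$ with $fA<A$ for all $f\in K$, let $\operatorname{res}_A^V\colon\Omega^1_{K/k}\to k$ be the abstract residue: the unique $k$-linear map such that $\operatorname{res}_A^V(f\,dg)=\operatorname{tr}_V(f_1g_1-g_1f_1)$ for all $f,g\in K$ and all $f_1,g_1\in E_A$ with $f-f_1\in E_{2,A}$, $g-g_1\in E_{2,A}$, and $f_1\in E_{1,A}$ or $g_1\in E_{1,A}$. The Segal–Wilson cocycle of $A$ is $$c_A(g,h)=\exp_{z^2}\!\big(\tfrac12\operatorname{res}_A^V(g\,dh)\big)\in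 k((z))^\times\quad(g,h\in K),\qquad \exp_{z^2}(x)=\sum_{n\ge0}\frac{x^n}{n!}z^{2n}\quad(x\in k).$$ Let $\{V_i\}_{i\in I}$ be a family of $k$-subspaces of $V$ such that for every $f\in K$ one has $fV_i<V_i$ for all $i\in I$, and $fV_i=V_i$ or $fV_i=\{0\}$ for all but finitely many $i\in I$. Suppose that the family is reciprocity-admissible: $\sum_{i\in I}V_i\sim V$, and $V_i\cap\sum_{j\ne i}V_j\sim\{0\}$ for every $i\in I$. Then for all $g,h\in K$ only finitely many of the elements $c_{V_i}(g,h)$ are different from $1$, and $$\prod_{i\in I}c_{V_i}(g,h)=1\in k((z))^\times .$$ -/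

import Mathlib

open scoped LaurentSeries

namespace SegalWilson

section Commensurability

variable {k V : Type*} [Field k] [AddCommGroup V] [Module k V]

/-- `A < B`: the quotient `(A + B) / B` is finite dimensional. -/
def AlmostLE (A B : Submodule k V) : Prop :=
  FiniteDimensional k (↥(A ⊔ B) ⧸ B.submoduleOf (A ⊔ B))

/-- `A ∼ B`: the quotient `(A + B) / (A ∩ B)` is finite dimensional. -/
def Commensurable (A B : Submodule k V) : Prop :=
  FiniteDimensional k (↥(A ⊔ B) ⧸ (A ⊓ B).submoduleOf (A ⊔ B))

theorem almostLE_iff_map {A B : Submodule k V} :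
    AlmostLE A B ↔ FiniteDimensional k (A.map B.mkQ) := by
  have hker : LinearMap.ker (B.mkQ ∘ₗ (A ⊔ B).subtype) = B.submoduleOf (A ⊔ B) := by
    ext x
    simp [Submodule.submoduleOf]
  have hrange : LinearMap.range (B.mkQ ∘ₗ (A ⊔ B).subtype) = A.map B.mkQ := by
    rw [LinearMap.range_comp, Submodule.range_subtype, Submodule.map_sup]
    simp
  have e := (B.mkQ ∘ₗ (A ⊔ B).subtype).quotKerEquivRange
  rw [hker, hrange] at e
  exact ⟨fun (h : FiniteDimensional k _) => Module.Finite.equiv e,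
    fun h => Module.Finite.equiv e.symm⟩

theorem almostLE_iff {A B : Submodule k V} :
    AlmostLE A B ↔ ∃ F : Submodule k V, FiniteDimensional k F ∧ A ≤ B ⊔ F := by
  rw [almostLE_iff_map]
  constructor
  · intro h
    obtain ⟨s, hs⟩ := B.mkQ.exists_rightInverse_of_surjective B.range_mkQ
    refine ⟨(A.map B.mkQ).map s, inferInstance, fun a ha => ?_⟩
    have h1 : a - s (B.mkQ a) ∈ B := by
      have h0 : B.mkQ (s (B.mkQ a)) = B.mkQ a := LinearMap.congr_fun hs (B.mkQ a)
      have h1 : B.mkQ (a - s (B.mkQ a)) = 0 := by rw [map_sub, h0, sub_self]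
      exact (Submodule.Quotient.mk_eq_zero B).1 h1
    have h2 : s (B.mkQ a) ∈ (A.map B.mkQ).map s :=
      Submodule.mem_map_of_mem (Submodule.mem_map_of_mem ha)
    have := Submodule.add_mem_sup h1 h2
    simpa using this
  · rintro ⟨F, hF, hA⟩
    have : A.map B.mkQ ≤ F.map B.mkQ := by
      refine (Submodule.map_mono hA).trans ?_
      rw [Submodule.map_sup]
      simp
    exact Submodule.finiteDimensional_of_le this

theorem almostLE_bot_iff {A : Submodule k V} : AlmostLE A ⊥ ↔ FiniteDimensional k A := by
  rw [almostLE_iff]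
  constructor
  · rintro ⟨F, hF, h⟩
    rw [bot_sup_eq] at h
    exact Submodule.finiteDimensional_of_le h
  · intro h
    exact ⟨A, h, le_sup_right⟩

theorem AlmostLE.of_le {A B : Submodule k V} (h : A ≤ B) : AlmostLE A B :=
  almostLE_iff.2 ⟨⊥, inferInstance, h.trans le_sup_left⟩

theorem AlmostLE.mono {A B C : Submodule k V} (h : A ≤ B) (hB : AlmostLE B C) :
    AlmostLE A C := by
  obtain ⟨F, hF, h'⟩ := almostLE_iff.1 hB
  exact almostLE_iff.2 ⟨F, hF, h.trans h'⟩

theorem AlmostLE.trans {A B C : Submodule k V} (h : AlmostLE A B) (h' : AlmostLE B C) :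
    AlmostLE A C := by
  obtain ⟨F, hF, h⟩ := almostLE_iff.1 h
  obtain ⟨G, hG, h'⟩ := almostLE_iff.1 h'
  refine almostLE_iff.2 ⟨G ⊔ F, inferInstance, h.trans ?_⟩
  rw [← sup_assoc]
  exact sup_le_sup_right h' F

theorem AlmostLE.sup {A B C : Submodule k V} (h : AlmostLE A C) (h' : AlmostLE B C) :
    AlmostLE (A ⊔ B) C := by
  obtain ⟨F, hF, h⟩ := almostLE_iff.1 h
  obtain ⟨G, hG, h'⟩ := almostLE_iff.1 h'
  exact almostLE_iff.2 ⟨F ⊔ G, inferInstance,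
    sup_le (h.trans (sup_le_sup_left le_sup_left C)) (h'.trans (sup_le_sup_left le_sup_right C))⟩

theorem AlmostLE.map {A B : Submodule k V} (h : AlmostLE A B) (φ : Module.End k V) :
    AlmostLE (A.map φ) (B.map φ) := by
  obtain ⟨F, hF, h⟩ := almostLE_iff.1 h
  refine almostLE_iff.2 ⟨F.map φ, inferInstance, (Submodule.map_mono h).trans ?_⟩
  rw [Submodule.map_sup]

end Commensurability

section Operators

variable {k V : Type*} [Field k] [AddCommGroup V] [Module k V]

theorem map_add_le' (φ ψ : Module.End k V) (B : Submodule k V) :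
    B.map (φ + ψ) ≤ B.map φ ⊔ B.map ψ := by
  rintro _ ⟨x, hx, rfl⟩
  exact Submodule.add_mem_sup (Submodule.mem_map_of_mem hx) (Submodule.mem_map_of_mem hx)

theorem map_smul_le' (c : k) (φ : Module.End k V) (B : Submodule k V) :
    B.map (c • φ) ≤ B.map φ := by
  rintro _ ⟨x, hx, rfl⟩
  exact Submodule.smul_mem _ c (Submodule.mem_map_of_mem hx)

/-- The space of endomorphisms `φ` of `V` with `φ B < A`. -/
def almostMaps (B A : Submodule k V) : Submodule k (Module.End k V) where
  carrier := {φ | AlmostLE (B.map φ) A}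
  add_mem' {φ ψ} hφ hψ := (AlmostLE.sup hφ hψ).mono (map_add_le' φ ψ B)
  zero_mem' := AlmostLE.of_le (by simp)
  smul_mem' c φ hφ := AlmostLE.mono (map_smul_le' c φ B) hφ

/-- `φ ∈ E ↔ φ A < A`. -/
def E (A : Submodule k V) : Submodule k (Module.End k V) := almostMaps A A

/-- `φ ∈ E₁ ↔ φ V < A`. -/
def E₁ (A : Submodule k V) : Submodule k (Module.End k V) := almostMaps ⊤ A

/-- `φ ∈ E₂ ↔ φ A < (0)`. -/
def E₂ (A : Submodule k V) : Submodule k (Module.End k V) := almostMaps A ⊥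

/-- `φ ∈ E₀ ↔ φ V < A` and `φ A < (0)`. -/
def E₀ (A : Submodule k V) : Submodule k (Module.End k V) := E₁ A ⊓ E₂ A

theorem mem_almostMaps {A B : Submodule k V} {φ : Module.End k V} :
    φ ∈ almostMaps B A ↔ AlmostLE (B.map φ) A := Iff.rfl

theorem mul_mem_almostMaps {A B C : Submodule k V} {φ ψ : Module.End k V}
    (hφ : φ ∈ almostMaps B C) (hψ : ψ ∈ almostMaps A B) : φ * ψ ∈ almostMaps A C := by
  rw [mem_almostMaps, Module.End.mul_eq_comp, Submodule.map_comp]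
  exact (AlmostLE.map hψ φ).trans hφ

theorem almostMaps_mono {A B C D : Submodule k V} (h : A ≤ B) (h' : C ≤ D) :
    almostMaps B C ≤ almostMaps A D := fun _ hφ =>
  (AlmostLE.mono (Submodule.map_mono h) hφ).trans (AlmostLE.of_le h')

theorem E₁_le_E (A : Submodule k V) : E₁ A ≤ E A := almostMaps_mono le_top le_rfl

theorem E₂_le_E (A : Submodule k V) : E₂ A ≤ E A := almostMaps_mono le_rfl bot_le

/-- `φ` is finite potent: `φⁿ V` is finite dimensional for some `n`. -/
def IsFinitePotent (φ : Module.End k V) : Prop :=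
  ∃ n : ℕ, FiniteDimensional k (LinearMap.range (φ ^ n))

theorem mapsTo_range_pow (φ : Module.End k V) (n : ℕ) :
    ∀ x ∈ LinearMap.range (φ ^ n), φ x ∈ LinearMap.range (φ ^ n) := by
  rintro _ ⟨y, rfl⟩
  refine ⟨φ y, ?_⟩
  rw [← Module.End.mul_apply, ← Module.End.mul_apply, ← pow_succ, pow_succ']

open Classical in
/-- The trace of a finite potent endomorphism: the ordinary trace of its restriction to a finite
dimensional image `φⁿ V`. (The value `0` is used if `φ` is not finite potent.) -/
noncomputable def finitePotentTrace (φ : Module.End k V) : k :=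
  if h : IsFinitePotent φ then
    LinearMap.trace k (LinearMap.range (φ ^ h.choose))
      (φ.restrict (mapsTo_range_pow φ h.choose))
  else 0

theorem trace_restrict_congr {φ : Module.End k V} {U W : Submodule k V} (h : U = W)
    (hU : ∀ x ∈ U, φ x ∈ U) (hW : ∀ x ∈ W, φ x ∈ W) :
    LinearMap.trace k U (φ.restrict hU) = LinearMap.trace k W (φ.restrict hW) := by
  subst h
  rfl

theorem trace_restrict_of_image_le {φ : Module.End k V} {U W : Submodule k V}
    [FiniteDimensional k W] (hUW : U ≤ W)
    (hU : ∀ x ∈ U, φ x ∈ U) (hW : ∀ x ∈ W, φ x ∈ W) (h : W.map φ ≤ U) :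
    LinearMap.trace k W (φ.restrict hW) = LinearMap.trace k U (φ.restrict hU) := by
  have : FiniteDimensional k U := Submodule.finiteDimensional_of_le hUW
  have h1 : φ.restrict hW = (Submodule.inclusion hUW) ∘ₗ
      (φ.restrict (p := W) (q := U) (fun x hx => h (Submodule.mem_map_of_mem hx))) := by
    ext x; rfl
  have h2 : φ.restrict hU =
      (φ.restrict (p := W) (q := U) (fun x hx => h (Submodule.mem_map_of_mem hx))) ∘ₗ
      (Submodule.inclusion hUW) := by
    ext x; rfl
  rw [h1, h2, LinearMap.trace_comp_comm']

theorem trace_restrict_of_pow_image_le {φ : Module.End k V} {U : Submodule k V}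
    (hU : ∀ x ∈ U, φ x ∈ U) (n : ℕ) :
    ∀ (W : Submodule k V) [FiniteDimensional k W] (_ : U ≤ W)
      (hW : ∀ x ∈ W, φ x ∈ W) (_ : W.map (φ ^ n) ≤ U),
    LinearMap.trace k W (φ.restrict hW) = LinearMap.trace k U (φ.restrict hU) := by
  induction n with
  | zero =>
    intro W _ hUW hW h
    have : W = U := le_antisymm (by simpa [Module.End.one_eq_id] using h) hUW
    exact trace_restrict_congr this hW hU
  | succ n ih =>
    intro W _ hUW hW h
    have hle : W.map φ ⊔ U ≤ W := sup_le (Submodule.map_le_iff_le_comap.2 hW) hUW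
    have hW' : ∀ x ∈ W.map φ ⊔ U, φ x ∈ W.map φ ⊔ U := fun x hx =>
      Submodule.mem_sup_left (Submodule.mem_map_of_mem (hle hx))
    have : FiniteDimensional k ↥(W.map φ ⊔ U) := Submodule.finiteDimensional_of_le hle
    rw [trace_restrict_of_image_le hle hW' hW le_sup_left]
    refine ih _ le_sup_right hW' ?_
    rw [Submodule.map_sup, ← Submodule.map_comp, ← Module.End.mul_eq_comp, ← pow_succ]
    refine sup_le h ?_
    rw [Submodule.map_le_iff_le_comap]
    intro x hx
    exact Module.End.pow_apply_mem_of_forall_mem n hU x hx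

theorem trace_restrict_eq_trace_restrict {φ : Module.End k V} {U W : Submodule k V}
    [FiniteDimensional k U] [FiniteDimensional k W]
    (hU : ∀ x ∈ U, φ x ∈ U) (hW : ∀ x ∈ W, φ x ∈ W) {m n : ℕ}
    (h : LinearMap.range (φ ^ m) ≤ U) (h' : LinearMap.range (φ ^ n) ≤ W) :
    LinearMap.trace k U (φ.restrict hU) = LinearMap.trace k W (φ.restrict hW) := by
  have hUW : ∀ x ∈ U ⊓ W, φ x ∈ U ⊓ W := fun x hx => ⟨hU x hx.1, hW x hx.2⟩
  rw [trace_restrict_of_pow_image_le hUW n U inf_le_left hU,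
    trace_restrict_of_pow_image_le hUW m W inf_le_right hW]
  · rintro _ ⟨x, hx, rfl⟩
    exact ⟨h ⟨x, rfl⟩, Module.End.pow_apply_mem_of_forall_mem m hW x hx⟩
  · rintro _ ⟨x, hx, rfl⟩
    exact ⟨Module.End.pow_apply_mem_of_forall_mem n hU x hx, h' ⟨x, rfl⟩⟩

/-- The trace can be computed on every finite dimensional invariant subspace that contains some
`φⁿ V`. -/
theorem finitePotentTrace_eq {φ : Module.End k V} {W : Submodule k V} [FiniteDimensional k W]
    (hW : ∀ x ∈ W, φ x ∈ W) {n : ℕ} (h : LinearMap.range (φ ^ n) ≤ W) :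
    finitePotentTrace φ = LinearMap.trace k W (φ.restrict hW) := by
  have hφ : IsFinitePotent φ := ⟨n, Submodule.finiteDimensional_of_le h⟩
  have := hφ.choose_spec
  rw [finitePotentTrace, dif_pos hφ]
  exact trace_restrict_eq_trace_restrict _ _ le_rfl h

theorem finitePotentTrace_mul_comm {f g : Module.End k V} (h : IsFinitePotent (f * g)) :
    finitePotentTrace (f * g) = finitePotentTrace (g * f) := by
  obtain ⟨n, hn⟩ := h
  set W := LinearMap.range ((f * g) ^ n) with hWdef
  have hW : ∀ x ∈ W, (f * g) x ∈ W := mapsTo_range_pow _ n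
  have hU : ∀ x ∈ W.map g, (g * f) x ∈ W.map g := by
    rintro _ ⟨x, hx, rfl⟩
    exact Submodule.mem_map_of_mem (hW x hx)
  have hpow : LinearMap.range ((g * f) ^ (n + 1)) ≤ W.map g := by
    rintro _ ⟨x, rfl⟩
    rw [pow_succ, ← mul_assoc, mul_pow_mul]
    exact Submodule.mem_map_of_mem ⟨f x, rfl⟩
  rw [finitePotentTrace_eq hW le_rfl, finitePotentTrace_eq hU hpow]
  let g' : W →ₗ[k] W.map g :=
    g.restrict (p := W) (q := W.map g) (fun x hx => Submodule.mem_map_of_mem hx)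
  let f' : W.map g →ₗ[k] W := f.restrict (p := W.map g) (q := W) (by
    rintro _ ⟨x, hx, rfl⟩
    exact hW x hx)
  have h1 : (f * g).restrict hW = f' ∘ₗ g' := by ext x; rfl
  have h2 : (g * f).restrict hU = g' ∘ₗ f' := by ext x; rfl
  rw [h1, h2, LinearMap.trace_comp_comm']

theorem finiteDimensional_range_mul {A : Submodule k V} {φ ψ : Module.End k V}
    (hφ : φ ∈ E₀ A) (hψ : ψ ∈ E₀ A) : FiniteDimensional k (LinearMap.range (φ * ψ)) := by
  rw [← Submodule.map_top, ← almostLE_bot_iff]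
  exact mul_mem_almostMaps hφ.2 hψ.1

theorem isFinitePotent_of_mem {A : Submodule k V} {φ : Module.End k V} (hφ : φ ∈ E₀ A) :
    IsFinitePotent φ :=
  ⟨2, by rw [pow_two]; exact finiteDimensional_range_mul hφ hφ⟩

theorem exists_common {A : Submodule k V} {φ ψ : Module.End k V}
    (hφ : φ ∈ E₀ A) (hψ : ψ ∈ E₀ A) : ∃ W : Submodule k V, FiniteDimensional k W ∧
      ∀ a b : k, (∀ x ∈ W, (a • φ + b • ψ) x ∈ W) ∧
        LinearMap.range ((a • φ + b • ψ) ^ 2) ≤ W := by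
  have := finiteDimensional_range_mul hφ hφ
  have := finiteDimensional_range_mul hφ hψ
  have := finiteDimensional_range_mul hψ hφ
  have := finiteDimensional_range_mul hψ hψ
  set W := (LinearMap.range (φ * φ) ⊔ LinearMap.range (φ * ψ)) ⊔
    (LinearMap.range (ψ * φ) ⊔ LinearMap.range (ψ * ψ)) with hW
  have m1 : ∀ x, φ (φ x) ∈ W := fun x =>
    Submodule.mem_sup_left (Submodule.mem_sup_left ⟨x, rfl⟩)
  have m2 : ∀ x, φ (ψ x) ∈ W := fun x =>
    Submodule.mem_sup_left (Submodule.mem_sup_right ⟨x, rfl⟩)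
  have m3 : ∀ x, ψ (φ x) ∈ W := fun x =>
    Submodule.mem_sup_right (Submodule.mem_sup_left ⟨x, rfl⟩)
  have m4 : ∀ x, ψ (ψ x) ∈ W := fun x =>
    Submodule.mem_sup_right (Submodule.mem_sup_right ⟨x, rfl⟩)
  have hWφ : W ≤ W.comap φ := by
    refine sup_le (sup_le ?_ ?_) (sup_le ?_ ?_) <;> rintro _ ⟨x, rfl⟩
    exacts [m1 (φ x), m1 (ψ x), m2 (φ x), m2 (ψ x)]
  have hWψ : W ≤ W.comap ψ := by
    refine sup_le (sup_le ?_ ?_) (sup_le ?_ ?_) <;> rintro _ ⟨x, rfl⟩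
    exacts [m3 (φ x), m3 (ψ x), m4 (φ x), m4 (ψ x)]
  refine ⟨W, inferInstance, fun a b => ⟨fun x hx => ?_, ?_⟩⟩
  · exact W.add_mem (W.smul_mem a (hWφ hx)) (W.smul_mem b (hWψ hx))
  · rintro _ ⟨x, rfl⟩
    simp only [pow_two, Module.End.mul_apply, LinearMap.add_apply, LinearMap.smul_apply, map_add,
      map_smul]
    exact W.add_mem
      (W.smul_mem a (W.add_mem (W.smul_mem a (m1 x)) (W.smul_mem b (m3 x))))
      (W.smul_mem b (W.add_mem (W.smul_mem a (m2 x)) (W.smul_mem b (m4 x))))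

theorem finitePotentTrace_lin {A : Submodule k V} {φ ψ : Module.End k V}
    (hφ : φ ∈ E₀ A) (hψ : ψ ∈ E₀ A) (a b : k) :
    finitePotentTrace (a • φ + b • ψ) = a * finitePotentTrace φ + b * finitePotentTrace ψ := by
  obtain ⟨W, hfin, hW⟩ := exists_common hφ hψ
  have h1 := hW 1 0
  have h2 := hW 0 1
  simp only [one_smul, zero_smul, add_zero, zero_add] at h1 h2
  rw [finitePotentTrace_eq (hW a b).1 (hW a b).2, finitePotentTrace_eq h1.1 h1.2,
    finitePotentTrace_eq h2.1 h2.2, ← smul_eq_mul, ← smul_eq_mul, ← map_smul, ← map_smul,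
    ← map_add]
  rfl

theorem finitePotentTrace_add {A : Submodule k V} {φ ψ : Module.End k V}
    (hφ : φ ∈ E₀ A) (hψ : ψ ∈ E₀ A) :
    finitePotentTrace (φ + ψ) = finitePotentTrace φ + finitePotentTrace ψ := by
  simpa using finitePotentTrace_lin hφ hψ 1 1

theorem finitePotentTrace_sub {A : Submodule k V} {φ ψ : Module.End k V}
    (hφ : φ ∈ E₀ A) (hψ : ψ ∈ E₀ A) :
    finitePotentTrace (φ - ψ) = finitePotentTrace φ - finitePotentTrace ψ := by
  simpa [sub_eq_add_neg] using finitePotentTrace_lin hφ hψ 1 (-1)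

theorem finitePotentTrace_smul {A : Submodule k V} {φ : Module.End k V}
    (hφ : φ ∈ E₀ A) (a : k) :
    finitePotentTrace (a • φ) = a * finitePotentTrace φ := by
  simpa using finitePotentTrace_lin hφ hφ a 0

theorem mem_top_top (φ : Module.End k V) : φ ∈ almostMaps ⊤ (⊤ : Submodule k V) :=
  AlmostLE.of_le le_top

theorem mem_bot_bot (φ : Module.End k V) : φ ∈ almostMaps ⊥ (⊥ : Submodule k V) :=
  AlmostLE.of_le (by simp)

theorem mul_mem_E {A : Submodule k V} {f g : Module.End k V} (hf : f ∈ E A) (hg : g ∈ E A) :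
    f * g ∈ E A := mul_mem_almostMaps hf hg

theorem mul_mem_E₁_left {A : Submodule k V} {f g : Module.End k V} (hf : f ∈ E₁ A) :
    f * g ∈ E₁ A := mul_mem_almostMaps hf (mem_top_top g)

theorem mul_mem_E₁_right {A : Submodule k V} {f g : Module.End k V} (hf : f ∈ E A)
    (hg : g ∈ E₁ A) : f * g ∈ E₁ A := mul_mem_almostMaps hf hg

theorem mul_mem_E₂_left {A : Submodule k V} {f g : Module.End k V} (hf : f ∈ E₂ A)
    (hg : g ∈ E A) : f * g ∈ E₂ A := mul_mem_almostMaps hf hg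

theorem mul_mem_E₂_right {A : Submodule k V} {f g : Module.End k V} (hg : g ∈ E₂ A) :
    f * g ∈ E₂ A := mul_mem_almostMaps (mem_bot_bot f) hg

theorem finitePotentTrace_commutator_of_mem {A : Submodule k V} {f g : Module.End k V}
    (h : f * g ∈ E₀ A) (h' : g * f ∈ E₀ A) : finitePotentTrace (f * g - g * f) = 0 := by
  rw [finitePotentTrace_sub h h', finitePotentTrace_mul_comm (isFinitePotent_of_mem h), sub_self]

theorem finitePotentTrace_commutator_E₀_E {A : Submodule k V} {f g : Module.End k V}
    (hf : f ∈ E₀ A) (hg : g ∈ E A) :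
    f * g - g * f ∈ E₀ A ∧ finitePotentTrace (f * g - g * f) = 0 := by
  have h : f * g ∈ E₀ A := ⟨mul_mem_E₁_left hf.1, mul_mem_E₂_left hf.2 hg⟩
  have h' : g * f ∈ E₀ A := ⟨mul_mem_E₁_right hg hf.1, mul_mem_E₂_right hf.2⟩
  exact ⟨sub_mem h h', finitePotentTrace_commutator_of_mem h h'⟩

theorem finitePotentTrace_commutator_E₁_E₂ {A : Submodule k V} {f g : Module.End k V}
    (hf : f ∈ E₁ A) (hg : g ∈ E₂ A) :
    f * g - g * f ∈ E₀ A ∧ finitePotentTrace (f * g - g * f) = 0 := by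
  have h : f * g ∈ E₀ A := ⟨mul_mem_E₁_left hf, mul_mem_E₂_right hg⟩
  have h' : g * f ∈ E₀ A := ⟨mul_mem_E₁_right (E₂_le_E A hg) hf,
    mul_mem_E₂_left hg (E₁_le_E A hf)⟩
  exact ⟨sub_mem h h', finitePotentTrace_commutator_of_mem h h'⟩

/-- `(f₁, g₁)` can be used to compute the residue for the pair `(f, g)` of operators: `f₁` and `g₁`
are in `E`, `f ≡ f₁` and `g ≡ g₁` modulo `E₂`, and `f₁ ∈ E₁` or `g₁ ∈ E₁`. -/
structure IsResiduePair (A : Submodule k V) (f g f₁ g₁ : Module.End k V) : Prop where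
  left_mem : f₁ ∈ E A
  right_mem : g₁ ∈ E A
  left_congr : f - f₁ ∈ E₂ A
  right_congr : g - g₁ ∈ E₂ A
  mem_or_mem : f₁ ∈ E₁ A ∨ g₁ ∈ E₁ A

theorem IsResiduePair.symm {A : Submodule k V} {f g f₁ g₁ : Module.End k V}
    (h : IsResiduePair A f g f₁ g₁) : IsResiduePair A g f g₁ f₁ :=
  ⟨h.right_mem, h.left_mem, h.right_congr, h.left_congr, h.mem_or_mem.symm⟩

theorem IsResiduePair.commutator_mem {A : Submodule k V} {f g f₁ g₁ : Module.End k V}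
    (h : IsResiduePair A f g f₁ g₁) (hfg : f * g = g * f) : f₁ * g₁ - g₁ * f₁ ∈ E₀ A := by
  have hg : g ∈ E A := by
    have := add_mem (E₂_le_E A h.right_congr) h.right_mem
    simpa using this
  have hf : f ∈ E A := by
    have := add_mem (E₂_le_E A h.left_congr) h.left_mem
    simpa using this
  refine ⟨?_, ?_⟩
  · rcases h.mem_or_mem with h1 | h1
    · exact sub_mem (mul_mem_E₁_left h1) (mul_mem_E₁_right h.right_mem h1)
    · exact sub_mem (mul_mem_E₁_right h.left_mem h1) (mul_mem_E₁_left h1)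
  · have e : f₁ * g₁ - g₁ * f₁ = ((g - g₁) * f + g₁ * (f - f₁)) -
        ((f - f₁) * g + f₁ * (g - g₁)) := by
      simp only [sub_mul, mul_sub, hfg]
      abel
    rw [e]
    exact sub_mem
      (add_mem (mul_mem_E₂_left h.right_congr hf) (mul_mem_E₂_right h.left_congr))
      (add_mem (mul_mem_E₂_left h.left_congr hg) (mul_mem_E₂_right h.right_congr))

theorem IsResiduePair.trace_eq_of_left {A : Submodule k V} {f g f₁ g₁ f₂ g₂ : Module.End k V}
    (h : IsResiduePair A f g f₁ g₁) (h' : IsResiduePair A f g f₂ g₂) (hfg : f * g = g * f)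
    (h1 : f₁ ∈ E₁ A) (h2 : f₂ ∈ E₁ A) :
    finitePotentTrace (f₁ * g₁ - g₁ * f₁) = finitePotentTrace (f₂ * g₂ - g₂ * f₂) := by
  have hf : f₁ - f₂ ∈ E₀ A := by
    refine ⟨sub_mem h1 h2, ?_⟩
    simpa using sub_mem h'.left_congr h.left_congr
  have hg : g₁ - g₂ ∈ E₂ A := by
    simpa using sub_mem h'.right_congr h.right_congr
  have a1 := finitePotentTrace_commutator_E₀_E hf h.right_mem
  have a2 := finitePotentTrace_commutator_E₁_E₂ h2 hg
  have a3 := h'.commutator_mem hfg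
  have e : f₁ * g₁ - g₁ * f₁ = (((f₁ - f₂) * g₁ - g₁ * (f₁ - f₂)) +
      (f₂ * (g₁ - g₂) - (g₁ - g₂) * f₂)) + (f₂ * g₂ - g₂ * f₂) := by
    simp only [sub_mul, mul_sub]
    abel
  rw [e, finitePotentTrace_add (add_mem a1.1 a2.1) a3, finitePotentTrace_add a1.1 a2.1, a1.2, a2.2]
  simp

theorem finitePotentTrace_commutator_neg {A : Submodule k V} {f g : Module.End k V}
    (h : f * g - g * f ∈ E₀ A) :
    finitePotentTrace (g * f - f * g) = - finitePotentTrace (f * g - g * f) := by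
  rw [← neg_sub, ← neg_one_smul k, finitePotentTrace_smul h]
  simp

theorem exists_projection (A : Submodule k V) :
    ∃ π : Module.End k V, (∀ x, π x ∈ A) ∧ ∀ x ∈ A, π x = x := by
  obtain ⟨p, hp⟩ := A.subtype.exists_leftInverse_of_injective A.ker_subtype
  exact ⟨A.subtype ∘ₗ p, fun x => (p x).2, fun x hx =>
    congrArg Subtype.val (LinearMap.congr_fun hp ⟨x, hx⟩)⟩

theorem mul_mem_E₁_of_forall_mem {A : Submodule k V} {π : Module.End k V} (hπ : ∀ x, π x ∈ A)
    (f : Module.End k V) : π * f ∈ E₁ A := by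
  refine AlmostLE.of_le ?_
  rintro _ ⟨x, -, rfl⟩
  exact hπ _

theorem sub_mul_mem_E₂ {A : Submodule k V} {π : Module.End k V} (hπ : ∀ x ∈ A, π x = x)
    {f : Module.End k V} (hf : f ∈ E A) : f - π * f ∈ E₂ A := by
  have h1 : (1 - π) ∈ almostMaps A (⊥ : Submodule k V) := by
    refine AlmostLE.of_le ?_
    rintro _ ⟨x, hx, rfl⟩
    simp [hπ x hx]
  have := mul_mem_almostMaps h1 hf
  rwa [sub_mul, one_mul] at this

theorem isResiduePair_projection {A : Submodule k V} {π : Module.End k V} (hπ : ∀ x, π x ∈ A)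
    (hπ' : ∀ x ∈ A, π x = x) {f g : Module.End k V} (hf : f ∈ E A) (hg : g ∈ E A) :
    IsResiduePair A f g (π * f) (π * g) :=
  ⟨E₁_le_E A (mul_mem_E₁_of_forall_mem hπ f), E₁_le_E A (mul_mem_E₁_of_forall_mem hπ g),
    sub_mul_mem_E₂ hπ' hf, sub_mul_mem_E₂ hπ' hg, Or.inl (mul_mem_E₁_of_forall_mem hπ f)⟩

theorem IsResiduePair.trace_eq_projection {A : Submodule k V} {π : Module.End k V}
    (hπ : ∀ x, π x ∈ A) (hπ' : ∀ x ∈ A, π x = x) {f g f₁ g₁ : Module.End k V} (hf : f ∈ E A)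
    (hg : g ∈ E A) (hfg : f * g = g * f) (h : IsResiduePair A f g f₁ g₁) :
    finitePotentTrace (f₁ * g₁ - g₁ * f₁) =
      finitePotentTrace ((π * f) * (π * g) - (π * g) * (π * f)) := by
  have hp := isResiduePair_projection hπ hπ' hf hg
  rcases h.mem_or_mem with h1 | h1
  · exact h.trace_eq_of_left hp hfg h1 (mul_mem_E₁_of_forall_mem hπ f)
  · have := h.symm.trace_eq_of_left hp.symm hfg.symm h1 (mul_mem_E₁_of_forall_mem hπ g)
    rw [finitePotentTrace_commutator_neg (h.symm.commutator_mem hfg.symm), this,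
      ← finitePotentTrace_commutator_neg (hp.symm.commutator_mem hfg.symm)]

end Operators

section Residue

variable {k K V : Type*} [Field k] [CommRing K] [Algebra k K] [AddCommGroup V] [Module k V]
  [Module K V] [IsScalarTower k K V]

/-- The operator on `V` given by an element of `K`. -/
def op (k : Type*) {K : Type*} (V : Type*) [Field k] [CommRing K] [Algebra k K] [AddCommGroup V]
    [Module k V] [Module K V] [IsScalarTower k K V] (f : K) : Module.End k V :=
  Algebra.lsmul k k V f

/-- The characteristic property of the residue map `res_A^V : Ω_{K/k} → k`:
`res_A^V (f dg) = tr_V [f₁, g₁]`. -/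
def IsAbstractResidue (A : Submodule k V) (r : Ω[K⁄k] →ₗ[k] k) : Prop :=
  ∀ (f g : K) (f₁ g₁ : Module.End k V), IsResiduePair A (op k V f) (op k V g) f₁ g₁ →
    r (f • KaehlerDifferential.D k K g) = finitePotentTrace (f₁ * g₁ - g₁ * f₁)

theorem op_mul_comm (f g : K) : op k V f * op k V g = op k V g * op k V f := by
  simp only [op, ← map_mul, mul_comm]

theorem exists_linearMap_kaehler (r : K →ₗ[k] K →ₗ[k] k)
    (hr : ∀ f g h, r f (g * h) = r (f * g) h + r (f * h) g) :
    ∃ R : Ω[K⁄k] →ₗ[k] k, ∀ f g, R (f • KaehlerDifferential.D k K g) = r f g := by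
  let _ : Module K (K →ₗ[k] k) :=
    { smul := fun a φ => φ ∘ₗ LinearMap.mulLeft k a
      one_smul := fun φ => LinearMap.ext fun x => congrArg φ (one_mul x)
      mul_smul := fun a b φ => LinearMap.ext fun x => congrArg φ (by
        simp [mul_left_comm])
      smul_zero := fun a => rfl
      smul_add := fun a φ ψ => rfl
      add_smul := fun a b φ => LinearMap.ext fun x => by
        change φ ((a + b) * x) = φ (a * x) + φ (b * x)
        rw [add_mul, map_add]
      zero_smul := fun φ => LinearMap.ext fun x => by
        change φ (0 * x) = 0
        rw [zero_mul, map_zero] }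
  have hsmul : ∀ (a : K) (φ : K →ₗ[k] k) (x : K), (a • φ) x = φ (a * x) := fun _ _ _ => rfl
  have : IsScalarTower k K (K →ₗ[k] k) := ⟨fun c a φ => LinearMap.ext fun x => by
    rw [hsmul, LinearMap.smul_apply, hsmul, smul_mul_assoc, map_smul]⟩
  let D : Derivation k K (K →ₗ[k] k) := Derivation.mk' r.flip fun a b => LinearMap.ext fun x => by
    rw [LinearMap.add_apply, hsmul, hsmul]
    simp only [LinearMap.flip_apply]
    rw [hr, add_comm, mul_comm b x, mul_comm a x, add_comm]
  refine ⟨(LinearMap.applyₗ (1 : K)) ∘ₗ (D.liftKaehlerDifferential.restrictScalars k), fun f g => ?_⟩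
  change (D.liftKaehlerDifferential (f • KaehlerDifferential.D k K g)) 1 = _
  rw [map_smul, Derivation.liftKaehlerDifferential_comp_D, hsmul, mul_one]
  rfl

theorem existsUnique_abstractResidue (A : Submodule k V) (hA : ∀ f : K, op k V f ∈ E A) :
    ∃! r : Ω[K⁄k] →ₗ[k] k, IsAbstractResidue A r := by
  obtain ⟨π, hπ, hπ'⟩ := exists_projection A
  have hp : ∀ f g : K, IsResiduePair A (op k V f) (op k V g) (π * op k V f) (π * op k V g) :=
    fun f g => isResiduePair_projection hπ hπ' (hA f) (hA g)
  have hm : ∀ f g : K, (π * op k V f) * (π * op k V g) - (π * op k V g) * (π * op k V f) ∈ E₀ A :=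
    fun f g => (hp f g).commutator_mem (op_mul_comm f g)
  have op_add : ∀ f g : K, op k V (f + g) = op k V f + op k V g := fun f g => map_add _ f g
  have op_smul : ∀ (c : k) (f : K), op k V (c • f) = c • op k V f := fun c f => map_smul _ c f
  have op_mul : ∀ f g : K, op k V (f * g) = op k V f * op k V g := fun f g => map_mul _ f g
  let r : K →ₗ[k] K →ₗ[k] k := LinearMap.mk₂ k
    (fun f g => finitePotentTrace
      ((π * op k V f) * (π * op k V g) - (π * op k V g) * (π * op k V f)))
    (fun f f' g => by
      rw [← finitePotentTrace_add (hm f g) (hm f' g), op_add]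
      congr 1
      simp only [mul_add, add_mul]
      abel)
    (fun c f g => by
      rw [smul_eq_mul, ← finitePotentTrace_smul (hm f g), op_smul]
      congr 1
      simp only [mul_smul_comm, smul_mul_assoc, smul_sub])
    (fun f g g' => by
      rw [← finitePotentTrace_add (hm f g) (hm f g'), op_add]
      congr 1
      simp only [mul_add, add_mul]
      abel)
    (fun c f g => by
      rw [smul_eq_mul, ← finitePotentTrace_smul (hm f g), op_smul]
      congr 1
      simp only [mul_smul_comm, smul_mul_assoc, smul_sub])
  have hr : ∀ (f g : K) (f₁ g₁ : Module.End k V),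
      IsResiduePair A (op k V f) (op k V g) f₁ g₁ →
      finitePotentTrace (f₁ * g₁ - g₁ * f₁) = r f g := fun f g f₁ g₁ h =>
    h.trace_eq_projection hπ hπ' (hA f) (hA g) (op_mul_comm f g)
  have e1 : ∀ f : K, π * op k V f ∈ E₁ A := fun f => mul_mem_E₁_of_forall_mem hπ _
  have e2 : ∀ f : K, π * op k V f ∈ E A := fun f => E₁_le_E A (e1 f)
  have prod_congr : ∀ f g : K, op k V (f * g) - (π * op k V f) * (π * op k V g) ∈ E₂ A := by
    intro f g
    have : op k V (f * g) - (π * op k V f) * (π * op k V g) =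
        (op k V f - π * op k V f) * op k V g + (π * op k V f) * (op k V g - π * op k V g) := by
      rw [op_mul, sub_mul, mul_sub]
      abel
    rw [this]
    exact add_mem (mul_mem_E₂_left (sub_mul_mem_E₂ hπ' (hA f)) (hA g))
      (mul_mem_E₂_right (sub_mul_mem_E₂ hπ' (hA g)))
  have hder : ∀ f g h, r f (g * h) = r (f * g) h + r (f * h) g := by
    intro f g h
    set a := π * op k V f with ha
    set b := π * op k V g with hb
    set c := π * op k V h with hc
    have p1 : IsResiduePair A (op k V f) (op k V (g * h)) a (b * c) :=
      ⟨e2 f, mul_mem_E (e2 g) (e2 h), sub_mul_mem_E₂ hπ' (hA f), prod_congr g h, Or.inl (e1 f)⟩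
    have p2 : IsResiduePair A (op k V (f * g)) (op k V h) (a * b) c :=
      ⟨mul_mem_E (e2 f) (e2 g), e2 h, prod_congr f g, sub_mul_mem_E₂ hπ' (hA h), Or.inr (e1 h)⟩
    have p3 : IsResiduePair A (op k V (f * h)) (op k V g) (a * c) b :=
      ⟨mul_mem_E (e2 f) (e2 h), e2 g, prod_congr f h, sub_mul_mem_E₂ hπ' (hA g), Or.inr (e1 g)⟩
    have q := finitePotentTrace_commutator_E₀_E (hm f h) (e2 g)
    have m2 := p2.commutator_mem (op_mul_comm (f * g) h)
    have m3 := p3.commutator_mem (op_mul_comm (f * h) g)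
    rw [← hr _ _ _ _ p1, ← hr _ _ _ _ p2, ← hr _ _ _ _ p3, ← finitePotentTrace_add m2 m3]
    have e : a * b * c - c * (a * b) + (a * c * b - b * (a * c)) =
        (a * (b * c) - b * c * a) + ((a * c - c * a) * b - b * (a * c - c * a)) := by
      simp only [sub_mul, mul_sub, mul_assoc]
      abel
    rw [e, finitePotentTrace_add (p1.commutator_mem (op_mul_comm f (g * h))) q.1, q.2, add_zero]
  obtain ⟨R, hR⟩ := exists_linearMap_kaehler r hder
  refine ⟨R, fun f g f₁ g₁ h => by rw [hR, hr f g f₁ g₁ h], fun R' hR' => ?_⟩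
  have key : ∀ f g : K, R' (f • KaehlerDifferential.D k K g) =
      R (f • KaehlerDifferential.D k K g) := fun f g => by
    rw [hR, hR' f g _ _ (hp f g), hr f g _ _ (hp f g)]
  refine LinearMap.ext fun ω => ?_
  have hω : ω ∈ Submodule.span K (Set.range (KaehlerDifferential.D k K)) := by
    rw [KaehlerDifferential.span_range_derivation]
    trivial
  induction hω using Submodule.closure_induction with
  | zero => rw [map_zero, map_zero]
  | add x y _ _ hx hy => rw [map_add, map_add, hx, hy]
  | smul_mem a x hx =>
    obtain ⟨g, rfl⟩ := hx
    exact key a g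

/-- The abstract residue `res_A^V : Ω_{K/k} → k`, for a `K`-module `V` and a `k`-subspace `A` of
`V` with `f A < A` for all `f ∈ K`: the unique `k`-linear map with the characteristic property. -/
noncomputable def abstractResidue (A : Submodule k V) (hA : ∀ f : K, op k V f ∈ E A) :
    Ω[K⁄k] →ₗ[k] k :=
  (existsUnique_abstractResidue A hA).choose

theorem abstractResidue_spec (A : Submodule k V) (hA : ∀ f : K, op k V f ∈ E A) :
    IsAbstractResidue A (abstractResidue A hA) :=
  (existsUnique_abstractResidue A hA).choose_spec.1

end Residue

section Cocycle

/-- The power series `∑ₙ xⁿ z²ⁿ / n!`, that is `exp (x z²)`. -/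
noncomputable def expSqSeries {k : Type*} [Field k] [CharZero k] (x : k) : PowerSeries k :=
  PowerSeries.expand 2 two_ne_zero (PowerSeries.rescale x (PowerSeries.exp k))

theorem expSqSeries_mul_neg {k : Type*} [Field k] [CharZero k] (x : k) :
    expSqSeries x * expSqSeries (-x) = 1 := by
  rw [expSqSeries, expSqSeries, ← map_mul, PowerSeries.exp_mul_exp_eq_exp_add, add_neg_cancel]
  simp

theorem coeff_expSqSeries {k : Type*} [Field k] [CharZero k] (x : k) (n : ℕ) :
    PowerSeries.coeff (2 * n) (expSqSeries x) = x ^ n / (n.factorial : k) := by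
  simp [expSqSeries, PowerSeries.coeff_rescale, PowerSeries.coeff_exp, div_eq_mul_inv]

/-- `exp_{z²}(x) = ∑ₙ xⁿ z²ⁿ / n!` as an element of `k((z))ˣ`. -/
noncomputable def expSq {k : Type*} [Field k] [CharZero k] (x : k) : k⸨X⸩ˣ :=
  Units.map (HahnSeries.ofPowerSeries ℤ k : PowerSeries k →* k⸨X⸩)
    ⟨expSqSeries x, expSqSeries (-x), expSqSeries_mul_neg x, by
      simpa using expSqSeries_mul_neg (-x)⟩

/-- The Segal–Wilson cocycle `c_A^V(g, h) = exp_{z²}(½ res_A^V(g dh))`. -/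
noncomputable def segalWilsonCocycle {k K V : Type*} [Field k] [CharZero k] [CommRing K]
    [Algebra k K] [AddCommGroup V] [Module k V] [Module K V] [IsScalarTower k K V]
    (A : Submodule k V) (hA : ∀ f : K, op k V f ∈ E A) (g h : K) : k⸨X⸩ˣ :=
  expSq ((1 / 2 : k) * abstractResidue A hA (g • KaehlerDifferential.D k K h))

end Cocycle

section Families

variable {k V ι : Type*} [Field k] [AddCommGroup V] [Module k V]

/-- The set `E(V, {Vᵢ})` of the endomorphisms `g` of `V` with `g Vᵢ < Vᵢ` for all `i`, and
`g Vᵢ = Vᵢ` or `g Vᵢ = {0}` for almost all `i`. -/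
def restrictedEnd (W : ι → Submodule k V) : Set (Module.End k V) :=
  {g | (∀ i, g ∈ E (W i)) ∧ {i | ¬ ((W i).map g = W i ∨ (W i).map g = ⊥)}.Finite}

/-- A reciprocity-admissible family of subspaces: `∑ᵢ Vᵢ ∼ V`, and `Vᵢ ∩ ∑_{j ≠ i} Vⱼ ∼ {0}` for
all `i`. -/
structure IsReciprocityAdmissible (W : ι → Submodule k V) : Prop where
  sum_commensurable : Commensurable (⨆ i, W i) ⊤
  inf_commensurable : ∀ i, Commensurable (W i ⊓ ⨆ j, ⨆ _ : j ≠ i, W j) ⊥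

end Families

end SegalWilson

namespace SegalWilson

/-! ### Residues of pairs of commuting operators -/

section OperatorResidue

variable {k V : Type*} [Field k] [AddCommGroup V] [Module k V]

/-! Write res_A for the residue of the two commuting operators g and h along A. Three properties of
res_A give the reciprocity law. It depends on A only up to commensurability (`endResidue_congr`). It
vanishes if g and h map A into itself (`endResidue_eq_zero_of_forall_mem`). It satisfies res_{A+B} =
res_A + res_B when A ∩ B is finite dimensional (`endResidue_sup`).

All but finitely many V_i are stable under both g and h. Let s be a finite set containing the
exceptional indices and V_N the possibly infinite sum of the remaining V_i. Then V_N is stable, so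
its residue is 0, and adjoining the V_i with i ∈ s one at a time gives res_{ΣV_i} = Σ_{i∈s}
res_{V_i}; admissibility makes every intersection met on the way finite dimensional. Since ΣV_i ∼ V
and V is stable under everything, the left side is 0. As x ↦ exp(x z²) turns sums into products, the
product of the cocycles is 1.

The argument is run for two fixed operators rather than for the algebra K, so that almost-stability
of V_N has to be checked for g and h only. -/

theorem almostMaps_le_of_almostLE {A A' B B' : Submodule k V} (h : AlmostLE A' A)
    (h' : AlmostLE B B') : almostMaps A B ≤ almostMaps A' B' := fun φ hφ =>
  (AlmostLE.map h φ).trans (AlmostLE.trans hφ h')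

/-- The spaces E, E₁ and E₂ see only the commensurability class of A, so one and the same pair
computes the residue along A and along B. -/
theorem IsResiduePair.congr {A B : Submodule k V} (h : AlmostLE A B) (h' : AlmostLE B A)
    {f g f₁ g₁ : Module.End k V} (hp : IsResiduePair A f g f₁ g₁) :
    IsResiduePair B f g f₁ g₁ := by
  have h1 : E₁ A ≤ E₁ B := almostMaps_le_of_almostLE (.of_le le_rfl) h
  have h2 : E₂ A ≤ E₂ B := almostMaps_le_of_almostLE h' (.of_le le_rfl)
  have h3 : E A ≤ E B := almostMaps_le_of_almostLE h' h
  exact ⟨h3 hp.1, h3 hp.2, h2 hp.3, h2 hp.4, hp.5.imp (@h1 _) (@h1 _)⟩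

/-- The residue `tr_V [π f, π g]` of two commuting endomorphisms `f` and `g` of `V` along `A`,
where `π` is a projection onto `A`. -/
noncomputable def endResidue (A : Submodule k V) (f g : Module.End k V) : k :=
  finitePotentTrace
    (((exists_projection A).choose * f) * ((exists_projection A).choose * g) -
      ((exists_projection A).choose * g) * ((exists_projection A).choose * f))

variable {f g : Module.End k V}

theorem IsResiduePair.trace_eq_endResidue (hfg : f * g = g * f) {A : Submodule k V}
    {f₁ g₁ : Module.End k V} (hf : f ∈ E A) (hg : g ∈ E A) (h : IsResiduePair A f g f₁ g₁) :
    finitePotentTrace (f₁ * g₁ - g₁ * f₁) = endResidue A f g :=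
  h.trace_eq_projection (exists_projection A).choose_spec.1 (exists_projection A).choose_spec.2
    hf hg hfg

/-- It is enough to truncate one of the two operators. The residue becomes tr [πf, g], which is
linear in the projection π; the additivity in A rests on this. -/
theorem isResiduePair_of_left_mem_E₁ {A : Submodule k V} {f₁ : Module.End k V} (hg : g ∈ E A)
    (h : f - f₁ ∈ E₂ A) (h₁ : f₁ ∈ E₁ A) : IsResiduePair A f g f₁ g :=
  ⟨E₁_le_E A h₁, hg, h, by simp, Or.inl h₁⟩

theorem endResidue_congr (hfg : f * g = g * f) {A B : Submodule k V} (h : AlmostLE A B)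
    (h' : AlmostLE B A) (hf : f ∈ E A) (hg : g ∈ E A) :
    endResidue A f g = endResidue B f g := by
  obtain ⟨π, hπ, hπ'⟩ := exists_projection A
  have hp := isResiduePair_projection hπ hπ' hf hg
  have hE : E A ≤ E B := almostMaps_le_of_almostLE h' h
  rw [← hp.trace_eq_endResidue hfg hf hg, ← (hp.congr h h').trace_eq_endResidue hfg (hE hf) (hE hg)]

theorem finitePotentTrace_eq_zero_of_sq {φ : Module.End k V} (h : φ ^ 2 = 0) :
    finitePotentTrace φ = 0 := by
  have hb : ∀ x ∈ (⊥ : Submodule k V), φ x ∈ (⊥ : Submodule k V) := by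
    rintro x hx
    rw [Submodule.mem_bot] at hx
    simp [hx]
  rw [finitePotentTrace_eq (n := 2) hb (by simp [h]),
    Subsingleton.elim (φ.restrict hb) 0, map_zero]

/-- On A the operators πf and πg agree with f and g, so their commutator kills A; its image lies in
A. Hence its square is zero, although it need not vanish itself. -/
theorem endResidue_eq_zero_of_forall_mem (hfg : f * g = g * f) {A : Submodule k V}
    (hf : ∀ x ∈ A, f x ∈ A) (hg : ∀ x ∈ A, g x ∈ A) : endResidue A f g = 0 := by
  obtain ⟨π, hπ, hπ'⟩ := exists_projection A
  have hf' : f ∈ E A := AlmostLE.of_le (Submodule.map_le_iff_le_comap.2 hf)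
  have hg' : g ∈ E A := AlmostLE.of_le (Submodule.map_le_iff_le_comap.2 hg)
  rw [← (isResiduePair_projection hπ hπ' hf' hg').trace_eq_endResidue hfg hf' hg']
  apply finitePotentTrace_eq_zero_of_sq
  have h0 : ∀ x ∈ A, ((π * f) * (π * g) - (π * g) * (π * f)) x = 0 := fun x hx => by
    have hx' : f (g x) = g (f x) := LinearMap.congr_fun hfg x
    simp only [LinearMap.sub_apply, Module.End.mul_apply]
    rw [hπ' _ (hg x hx), hπ' _ (hf x hx), hx', sub_self]
  ext x
  rw [pow_two, Module.End.mul_apply, LinearMap.zero_apply]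
  exact h0 _ (sub_mem (hπ _) (hπ _))

/-! ### Additivity of the residue in the subspace -/

theorem mem_E_sup {A B : Submodule k V} (hA : f ∈ E A) (hB : f ∈ E B) : f ∈ E (A ⊔ B) := by
  refine mem_almostMaps.2 ?_
  rw [Submodule.map_sup]
  exact (AlmostLE.trans hA (.of_le le_sup_left)).sup (AlmostLE.trans hB (.of_le le_sup_right))

/-- Fixing one complement C of A ⊕ B and projecting along B ⊕ C and A ⊕ C makes each projection kill
the other summand. -/
theorem exists_projections {A B : Submodule k V} (h : Disjoint A B) :
    ∃ π ρ : Module.End k V, (∀ x, π x ∈ A) ∧ (∀ x ∈ A, π x = x) ∧ (∀ x ∈ B, π x = 0) ∧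
      (∀ x, ρ x ∈ B) ∧ (∀ x ∈ B, ρ x = x) ∧ (∀ x ∈ A, ρ x = 0) := by
  obtain ⟨C, hC⟩ := (A ⊔ B).exists_isCompl
  have hA : IsCompl A (B ⊔ C) :=
    ⟨h.disjoint_sup_right_of_disjoint_sup_left hC.1, by
      rw [codisjoint_iff, ← sup_assoc]
      exact hC.2.eq_top⟩
  have hB : IsCompl B (A ⊔ C) :=
    ⟨h.symm.disjoint_sup_right_of_disjoint_sup_left (by rw [sup_comm]; exact hC.1), by
      rw [codisjoint_iff, ← sup_assoc, sup_comm B A]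
      exact hC.2.eq_top⟩
  refine ⟨A.projection _ hA, B.projection _ hB, fun x => ?_, fun x hx => ?_, fun x hx => ?_, fun x => ?_,
    fun x hx => ?_, fun x hx => ?_⟩
  · exact Submodule.projection_apply_mem hA x
  · exact Submodule.projection_apply_left hA ⟨x, hx⟩
  · exact (Submodule.projection_apply_eq_zero_iff hA).2 (Submodule.mem_sup_left hx)
  · exact Submodule.projection_apply_mem hB x
  · exact Submodule.projection_apply_left hB ⟨x, hx⟩
  · exact (Submodule.projection_apply_eq_zero_iff hB).2 (Submodule.mem_sup_left hx)

theorem mem_almostMaps_sup_left {A B C : Submodule k V} (hA : f ∈ almostMaps A C)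
    (hB : f ∈ almostMaps B C) : f ∈ almostMaps (A ⊔ B) C := by
  refine mem_almostMaps.2 ?_
  rw [Submodule.map_sup]
  exact AlmostLE.sup hA hB

/-- `finitePotentTrace_add` needs both operators in a common E₀, and a priori [πf, g] lies only in
that of A. Since π kills B while f and g almost preserve B, the commutator has finite rank on B as
well. -/
theorem commutator_projection_mem_E₀_sup {A B : Submodule k V} {π : Module.End k V}
    (hπ : ∀ x, π x ∈ A) (hπ' : ∀ x ∈ A, π x = x) (hπB : ∀ x ∈ B, π x = 0)
    (hfg : f * g = g * f) (hfA : f ∈ E A) (hgA : g ∈ E A) (hfB : f ∈ E B) (hgB : g ∈ E B) :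
    π * f * g - g * (π * f) ∈ E₀ (A ⊔ B) := by
  have h := (isResiduePair_of_left_mem_E₁ hgA (sub_mul_mem_E₂ hπ' hfA)
    (mul_mem_E₁_of_forall_mem hπ f)).commutator_mem hfg
  have hπ0 : π ∈ E₂ B := AlmostLE.of_le (by
    rintro _ ⟨x, hx, rfl⟩
    exact hπB x hx)
  refine ⟨almostMaps_mono le_rfl le_sup_left h.1, mem_almostMaps_sup_left h.2 ?_⟩
  have hπf : π * f ∈ E₂ B := mul_mem_E₂_left hπ0 hfB
  exact sub_mem (mul_mem_E₂_left hπf hgB) (mul_mem_E₂_right hπf)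

/-- The sum π + ρ is a projection onto A ⊕ B, and [(π + ρ)f, g] = [πf, g] + [ρf, g]. -/
theorem endResidue_sup_of_disjoint (hfg : f * g = g * f) {A B : Submodule k V} (h : Disjoint A B)
    (hfA : f ∈ E A) (hgA : g ∈ E A) (hfB : f ∈ E B) (hgB : g ∈ E B) :
    endResidue (A ⊔ B) f g = endResidue A f g + endResidue B f g := by
  obtain ⟨π, ρ, hπ, hπ', hπ0, hρ, hρ', hρ0⟩ := exists_projections h
  have hf := mem_E_sup hfA hfB
  have hg := mem_E_sup hgA hgB
  have hs : ∀ x, (π + ρ) x ∈ A ⊔ B := fun x => Submodule.add_mem_sup (hπ x) (hρ x)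
  have hs' : ∀ x ∈ A ⊔ B, (π + ρ) x = x := fun x hx => by
    obtain ⟨a, ha, b, hb, rfl⟩ := Submodule.mem_sup.1 hx
    simp [hπ' a ha, hπ0 b hb, hρ' b hb, hρ0 a ha]
  have pA := isResiduePair_of_left_mem_E₁ hgA (sub_mul_mem_E₂ hπ' hfA)
    (mul_mem_E₁_of_forall_mem hπ f)
  have pB := isResiduePair_of_left_mem_E₁ hgB (sub_mul_mem_E₂ hρ' hfB)
    (mul_mem_E₁_of_forall_mem hρ f)
  have pS := isResiduePair_of_left_mem_E₁ hg (sub_mul_mem_E₂ hs' hf)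
    (mul_mem_E₁_of_forall_mem hs f)
  rw [← pA.trace_eq_endResidue hfg hfA hgA, ← pB.trace_eq_endResidue hfg hfB hgB,
    ← pS.trace_eq_endResidue hfg hf hg,
    ← finitePotentTrace_add (commutator_projection_mem_E₀_sup hπ hπ' hπ0 hfg hfA hgA hfB hgB)
      (by
        rw [sup_comm]
        exact commutator_projection_mem_E₀_sup hρ hρ' hρ0 hfg hfB hgB hfA hgA)]
  congr 1
  simp only [add_mul, mul_add]
  abel

/-- A complement of A ∩ B inside B is commensurable with B, is disjoint from A and has the same sum
with A, which reduces to the disjoint case. -/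
theorem endResidue_sup (hfg : f * g = g * f) {A B : Submodule k V} (h : AlmostLE (A ⊓ B) ⊥)
    (hfA : f ∈ E A) (hgA : g ∈ E A) (hfB : f ∈ E B) (hgB : g ∈ E B) :
    endResidue (A ⊔ B) f g = endResidue A f g + endResidue B f g := by
  obtain ⟨C, hC⟩ := (A ⊓ B).exists_isCompl
  -- Modular law: a complement of A ∩ B in V, cut down to B, is a complement in B.
  have hB : (A ⊓ B) ⊔ (C ⊓ B) = B := by
    rw [← sup_inf_assoc_of_le C inf_le_right, hC.2.eq_top, top_inf_eq]
  have hd : Disjoint A (C ⊓ B) := by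
    rw [disjoint_iff, inf_left_comm, inf_comm C]
    exact hC.1.eq_bot
  have hle : AlmostLE B (C ⊓ B) := by
    have := (h.trans (.of_le bot_le)).sup (AlmostLE.of_le (le_refl (C ⊓ B)))
    rwa [hB] at this
  have hle' : AlmostLE (C ⊓ B) B := .of_le inf_le_right
  have hE : E B ≤ E (C ⊓ B) := almostMaps_le_of_almostLE hle' hle
  have hsup : A ⊔ C ⊓ B = A ⊔ B := by
    conv_rhs => rw [← hB, ← sup_assoc, sup_inf_self]
  rw [endResidue_congr hfg hle hle' hfB hgB, ← hsup,
    endResidue_sup_of_disjoint hfg hd hfA hgA (hE hfB) (hE hgB)]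

/-! ### Families of subspaces and reciprocity -/

theorem mem_E_sup_biSup {ι : Type*} {W : ι → Submodule k V} {B : Submodule k V} (hB : f ∈ E B)
    (hf : ∀ i, f ∈ E (W i)) (s : Finset ι) : f ∈ E (B ⊔ ⨆ i ∈ s, W i) := by
  classical
  induction s using Finset.induction_on with
  | empty => simpa using hB
  | insert a s _ ih =>
    rw [Finset.iSup_insert, sup_left_comm]
    exact mem_E_sup (hf a) ih

theorem endResidue_sup_biSup (hfg : f * g = g * f) {ι : Type*} {W : ι → Submodule k V}
    (hf : ∀ i, f ∈ E (W i)) (hg : ∀ i, g ∈ E (W i))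
    (hW : ∀ i, AlmostLE (W i ⊓ ⨆ j, ⨆ _ : j ≠ i, W j) ⊥) {N : Set ι}
    (hfN : f ∈ E (⨆ i ∈ N, W i)) (hgN : g ∈ E (⨆ i ∈ N, W i)) (s : Finset ι)
    (hs : ∀ i ∈ s, i ∉ N) :
    endResidue ((⨆ i ∈ N, W i) ⊔ ⨆ i ∈ s, W i) f g =
      endResidue (⨆ i ∈ N, W i) f g + ∑ i ∈ s, endResidue (W i) f g := by
  classical
  induction s using Finset.induction_on with
  | empty => simp
  | insert a s ha ih =>
    -- The sum accumulated so far avoids the index a, so its intersection with `W a` is controlled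
    -- by `hW a`.
    have hle : (⨆ i ∈ N, W i) ⊔ ⨆ i ∈ s, W i ≤ ⨆ j, ⨆ _ : j ≠ a, W j := by
      refine sup_le (iSup₂_le fun i hi => ?_) (iSup₂_le fun i hi => ?_)
      · refine le_iSup₂_of_le i ?_ le_rfl
        rintro rfl
        exact hs _ (Finset.mem_insert_self _ _) hi
      · refine le_iSup₂_of_le i ?_ le_rfl
        rintro rfl
        exact ha hi
    rw [Finset.iSup_insert, sup_left_comm, Finset.sum_insert ha,
      endResidue_sup hfg (AlmostLE.mono (inf_le_inf_left _ hle) (hW a)) (hf a) (hg a)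
        (mem_E_sup_biSup hfN hf s) (mem_E_sup_biSup hgN hg s),
      ih fun i hi => hs i (Finset.mem_insert_of_mem hi)]
    ring

/-- Stability is all that the reciprocity argument retains of the alternative fV_i = V_i or fV_i =
0. -/
theorem forall_mem_of_map_eq_or {A : Submodule k V} (h : A.map f = A ∨ A.map f = ⊥) :
    ∀ x ∈ A, f x ∈ A :=
  Submodule.map_le_iff_le_comap.1 (h.elim (fun h => h.le) fun h => h.le.trans bot_le)

theorem forall_mem_biSup {ι : Type*} {W : ι → Submodule k V} {N : Set ι}
    (h : ∀ i ∈ N, ∀ x ∈ W i, f x ∈ W i) : ∀ x ∈ ⨆ i ∈ N, W i, f x ∈ ⨆ i ∈ N, W i := by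
  have hmap : (⨆ i ∈ N, W i).map f ≤ ⨆ i ∈ N, W i := by
    simp only [Submodule.map_iSup]
    exact iSup₂_mono fun i hi => Submodule.map_le_iff_le_comap.2 (h i hi)
  exact Submodule.map_le_iff_le_comap.1 hmap

/-- The reciprocity law for the residues of two commuting endomorphisms. -/
theorem IsReciprocityAdmissible.sum_endResidue_eq_zero (hfg : f * g = g * f) {ι : Type*}
    {W : ι → Submodule k V} (hW : IsReciprocityAdmissible W) (hf : ∀ i, f ∈ E (W i))
    (hg : ∀ i, g ∈ E (W i)) (s : Finset ι) (hfs : ∀ i ∉ s, ∀ x ∈ W i, f x ∈ W i)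
    (hgs : ∀ i ∉ s, ∀ x ∈ W i, g x ∈ W i) : ∑ i ∈ s, endResidue (W i) f g = 0 := by
  have hsup : AlmostLE ⊤ (⨆ i, W i) := by
    have := hW.sum_commensurable
    rwa [Commensurable, inf_top_eq, sup_comm] at this
  have hinf : ∀ i, AlmostLE (W i ⊓ ⨆ j, ⨆ _ : j ≠ i, W j) ⊥ := fun i => by
    have := hW.inf_commensurable i
    rwa [Commensurable, inf_bot_eq] at this
  let N : Set ι := {i | i ∉ s}
  have hfN := forall_mem_biSup (N := N) hfs
  have hgN := forall_mem_biSup (N := N) hgs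
  have hfN' : f ∈ E (⨆ i ∈ N, W i) := AlmostLE.of_le (Submodule.map_le_iff_le_comap.2 hfN)
  have hgN' : g ∈ E (⨆ i ∈ N, W i) := AlmostLE.of_le (Submodule.map_le_iff_le_comap.2 hgN)
  have h1 := endResidue_sup_biSup hfg hf hg hinf hfN' hgN' s fun i hi h => h hi
  have hall : (⨆ i ∈ N, W i) ⊔ ⨆ i ∈ s, W i = ⨆ i, W i := by
    refine le_antisymm (sup_le (iSup₂_le fun i _ => le_iSup W i)
      (iSup₂_le fun i _ => le_iSup W i)) (iSup_le fun i => ?_)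
    by_cases hi : i ∈ s
    · exact le_sup_of_le_right (le_iSup₂_of_le i hi le_rfl)
    · exact le_sup_of_le_left (le_iSup₂_of_le i hi le_rfl)
  -- The residue along V_N vanishes by stability; the one along ΣV_i equals the one along V, which
  -- vanishes too.
  rw [hall, endResidue_eq_zero_of_forall_mem hfg hfN hgN, zero_add,
    ← endResidue_congr hfg hsup (.of_le le_top) (mem_top_top f) (mem_top_top g),
    endResidue_eq_zero_of_forall_mem hfg (fun _ _ => Submodule.mem_top)
      fun _ _ => Submodule.mem_top] at h1
  exact h1.symm

end OperatorResidue

/-! ### Comparison with the abstract residue, and the exponential -/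

/-- The pair (πg, πh), for the projection chosen in `endResidue`, is admissible in the
characteristic property of the abstract residue. -/
theorem abstractResidue_smul_D {k K V : Type*} [Field k] [CommRing K] [Algebra k K]
    [AddCommGroup V] [Module k V] [Module K V] [IsScalarTower k K V] (A : Submodule k V)
    (hA : ∀ f : K, op k V f ∈ E A) (g h : K) :
    abstractResidue A hA (g • KaehlerDifferential.D k K h) =
      endResidue A (op k V g) (op k V h) :=
  abstractResidue_spec A hA g h _ _ (isResiduePair_projection (exists_projection A).choose_spec.1
    (exists_projection A).choose_spec.2 (hA g) (hA h))

section Exponential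

variable {k : Type*} [Field k] [CharZero k]

/-- This is exp(xz) exp(yz) = exp((x + y)z) carried through the ring homomorphism z ↦ z². -/
theorem expSqSeries_add (x y : k) : expSqSeries (x + y) = expSqSeries x * expSqSeries y := by
  rw [expSqSeries, expSqSeries, expSqSeries, ← map_mul, PowerSeries.exp_mul_exp_eq_exp_add]

theorem expSq_add (x y : k) : expSq (x + y) = expSq x * expSq y := by
  refine Units.ext ?_
  change HahnSeries.ofPowerSeries ℤ k _ =
    HahnSeries.ofPowerSeries ℤ k _ * HahnSeries.ofPowerSeries ℤ k _
  rw [← map_mul]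
  exact congrArg _ (expSqSeries_add x y)

theorem expSq_zero : expSq (0 : k) = 1 := by
  -- An idempotent element of a group is 1.
  have h := expSq_add (0 : k) 0
  rw [add_zero] at h
  exact left_eq_mul.1 h

theorem expSq_sum {ι : Type*} (s : Finset ι) (x : ι → k) :
    expSq (∑ i ∈ s, x i) = ∏ i ∈ s, expSq (x i) := by
  classical
  induction s using Finset.induction_on with
  | empty => simp [expSq_zero]
  | insert a s ha ih => rw [Finset.sum_insert ha, Finset.prod_insert ha, expSq_add, ih]

end Exponential

end SegalWilson

/-! ### The reciprocity law for the Segal–Wilson cocycle -/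

open SegalWilson in
theorem mainTheorem10 {k K V ι : Type*} [Field k] [CharZero k] [CommRing K] [Algebra k K]
    [AddCommGroup V] [Module k V] [Module K V] [IsScalarTower k K V] (W : ι → Submodule k V)
    (hK : ∀ f : K, SegalWilson.op k V f ∈ SegalWilson.restrictedEnd W)
    (hW : SegalWilson.IsReciprocityAdmissible W) (g h : K) :
    {i | SegalWilson.segalWilsonCocycle (W i) (fun f => (hK f).1 i) g h ≠ 1}.Finite ∧
      ∏ᶠ i, SegalWilson.segalWilsonCocycle (W i) (fun f => (hK f).1 i) g h = 1 := by
  classical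
  -- The exceptional indices of g and of h together; off `s` both operators preserve V_i, so the
  -- residue is 0 and the cocycle is 1.
  let s : Finset ι := (hK g).2.toFinset ∪ (hK h).2.toFinset
  have hgs : ∀ i ∉ s, ∀ x ∈ W i, op k V g x ∈ W i := fun i hi => forall_mem_of_map_eq_or (by
    by_contra hc
    exact hi (Finset.mem_union_left _ ((hK g).2.mem_toFinset.2 hc)))
  have hhs : ∀ i ∉ s, ∀ x ∈ W i, op k V h x ∈ W i := fun i hi => forall_mem_of_map_eq_or (by
    by_contra hc
    exact hi (Finset.mem_union_right _ ((hK h).2.mem_toFinset.2 hc)))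
  have hc : ∀ i, segalWilsonCocycle (W i) (fun f => (hK f).1 i) g h =
      expSq ((1 / 2 : k) * endResidue (W i) (op k V g) (op k V h)) := fun i => by
    rw [segalWilsonCocycle, abstractResidue_smul_D]
  have hsub : {i | segalWilsonCocycle (W i) (fun f => (hK f).1 i) g h ≠ 1} ⊆ ↑s := by
    intro i hi
    by_contra his
    refine hi ?_
    rw [hc, endResidue_eq_zero_of_forall_mem (op_mul_comm g h) (hgs i his) (hhs i his), mul_zero,
      expSq_zero]
  refine ⟨s.finite_toSet.subset hsub, ?_⟩
  rw [finprod_eq_prod_of_mulSupport_subset _ hsub, Finset.prod_congr rfl fun i _ => hc i,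
    ← expSq_sum, ← Finset.mul_sum, hW.sum_endResidue_eq_zero (op_mul_comm g h)
      (fun i => (hK g).1 i) (fun i => (hK h).1 i) s hgs hhs, mul_zero, expSq_zero]
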